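/- Let $(\Omega,\mathcal F,\mathbb P)$ be a complete probability space and let $(\gamma_t)_{t\ge 0}$ be a standard gamma process on it, i.e. a subordinator (started at $0$, independent and stationary increments, a.s. nondecreasing càdlàg paths) with no drift and $$\mathbb E\big[e^{-\lambda\gamma_t}\big]=\exp\Big(-t\int_0^\infty(1-e^{-\lambda x})\frac{e^{-x}}{x}\,dx\Big)=(1+\lambda)^{-t},\qquad \lambda,t\ge 0 .$$ Let $\tau:\Omega\to(0,\infty)$ be a random time that is independent of $\gamma$ and satisfies $\mathbb E[\tau^\alpha]<\infty$ for some $\alpha>0$. Let $$\zeta_t=\frac{\gamma_{t\wedge\tau}}{\gamma_\tau},\qquad t\ge 0,$$ be the gamma bridge of random length $\tau$. For $t\ge 0$ let $\mathcal F^{\zeta,c}_t=\sigma(\zeta_s,\,s\le t)\vee\mathcal N_{\mathbb P}$, where $\mathcal N_{\mathbb P}$ is the collection of $\mathbb P$-null sets. Then the completed natural filtration $\mathbb F^{\zeta,c}=(\mathcal F^{\zeta,c}_t)_{t\ge 0}$ of $\zeta$ satisfies the usual conditions: it is a filtration of $(\Omega,\mathcal F,\mathbb P)$, it is right-continuous,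 i.e. $\mathcal F^{\zeta,c}_t=\bigcap_{s>t}\mathcal F^{\zeta,c}_s$ for every $t\ge 0$, and it is complete, i.e. $\mathcal N_{\mathbb P}\subseteq\mathcal F^{\zeta,c}_0$. -/

import Mathlib

open MeasureTheory ProbabilityTheory Filter Topology
open scoped NNReal ENNReal

namespace GammaBridge

/-- A subordinator: a process started at `0`, with independent and stationary increments, whose
paths are almost surely nondecreasing and right-continuous. (A nondecreasing real path has left
limits everywhere, so almost every path is càdlàg, with values in `[0, ∞)`.) -/
structure IsSubordinator {Ω : Type*} [MeasurableSpace Ω] (X : ℝ≥0 → Ω → ℝ) (P : Measure Ω) : Prop where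
  measurable : ∀ t, Measurable (X t)
  zero : ∀ᵐ ω ∂P, X 0 ω = 0
  indep : HasIndepIncrements X P
  stationary : ∀ s h : ℝ≥0, IdentDistrib (fun ω => X (s + h) ω - X s ω) (X h) P P
  monotone : ∀ᵐ ω ∂P, Monotone fun t => X t ω
  rightCont : ∀ᵐ ω ∂P, ∀ t : ℝ≥0, ContinuousWithinAt (fun s => X s ω) (Set.Ioi t) t

/-- A standard gamma process: a driftless subordinator with Lévy measure `e^{-x} / x dx` on
`(0, ∞)`, that is, with the Laplace transform given by the Lévy-Khintchine formula
`E[exp (-l γ_t)] = exp (- t ∫_0^∞ (1 - e^{-l x}) e^{-x} / x dx)` for `l ≥ 0`. -/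
structure IsStandardGammaProcess {Ω : Type*} [MeasurableSpace Ω]
    (γ : ℝ≥0 → Ω → ℝ) (P : Measure Ω) : Prop
    extends IsSubordinator γ P where
  laplace : ∀ (t : ℝ≥0) (l : ℝ), 0 ≤ l →
    ∫ ω, Real.exp (-(l * γ t ω)) ∂P =
      Real.exp (-(t * ∫ x in Set.Ioi (0 : ℝ), (1 - Real.exp (-(l * x))) * (Real.exp (-x) / x)))

/-- The gamma bridge of random length `τ` associated with `γ`:
`ζ_t = γ_{t ∧ τ} / γ_τ`. -/
noncomputable def randomBridge {Ω : Type*} (γ : ℝ≥0 → Ω → ℝ) (τ : Ω → ℝ≥0)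
    (t : ℝ≥0) (ω : Ω) : ℝ :=
  γ (min t (τ ω)) ω / γ (τ ω) ω

/-- The σ-algebra `σ(Y_s, s ≤ t)`. -/
@[reducible] def naturalSigma {Ω : Type*} (Y : ℝ≥0 → Ω → ℝ) (t : ℝ≥0) : MeasurableSpace Ω :=
  ⨆ s ≤ t, MeasurableSpace.comap (Y s) inferInstance

/-- The σ-algebra `σ(Y_s, s ≤ t) ∨ N_P`, where `N_P` is the collection of `P`-null sets. -/
@[reducible] def completedNaturalSigma {Ω : Type*} [MeasurableSpace Ω]
    (Y : ℝ≥0 → Ω → ℝ) (P : Measure Ω) (t : ℝ≥0) : MeasurableSpace Ω :=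
  naturalSigma Y t ⊔ MeasurableSpace.generateFrom {N : Set Ω | P N = 0}

/-- The usual conditions for a filtration: right-continuity, and completeness, i.e. every
`P`-null set belongs to `𝓕 0` (and hence to every `𝓕 t`). -/
structure UsualConditions {Ω : Type*} {m : MeasurableSpace Ω} (𝓕 : Filtration ℝ≥0 m)
    (P : Measure Ω) : Prop where
  rightContinuous : 𝓕.IsRightContinuous
  complete : ∀ N : Set Ω, P N = 0 → MeasurableSet[𝓕 0] N

end GammaBridge

namespace GammaBridge

/-! Let `A` lie in every completed σ-algebra after `t`. Up to a null set, `A = {ζ ∈ B}` with `B` in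
the germ σ-algebra at `t` of path space, and the event is treated separately before and after `τ`.

Almost every path of `γ` is strictly increasing, so `{τ ≤ t} = {ζ_t = 1}` a.s. is visible at time
`t`. On this event `ζ` is frozen after `t`, and `{ζ ∈ B}` depends only on the stopped path.

On `{t < τ}` the result is transferred from `γ`. Blumenthal's law
(`exists_measurableSet_naturalSigma_ae_eq`) gives `C`, depending on the path up to `t`, with `{γ ∈
B} = {γ ∈ C}` a.s. For `u > t` the symmetric difference of `B` and `C` depends on the path up to `u`
and is null for `γ`. It is then null for `ζ` on `{u < τ}` by absolute continuity
(`ae_randomBridge_notMem`), and `u ↓ t`.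

For absolute continuity, freeze `τ = T > u`. Up to time `u` the bridge is `γ / (γ_u + R)`, where `R
= γ_T - γ_u` is independent of the past and has a density. By Fubini it suffices that dividing the
path by a constant `c > 0` preserves null sets. This is quasi-invariance: tilting by `exp (-l γ_u)`
has the effect of dividing the path on `[0, u]` by `1 + l`, because the Laplace exponent satisfies
`ψ(a + b) = ψ(a) + ψ(b / (1 + a))`. -/

/-! ### Independence of past and future increments -/

/-- Any finite set of times is contained in the range of a monotone sequence started at `0`. -/
theorem exists_monotone_seq_of_finset (I : Finset ℝ≥0) :
    ∃ t : ℕ → ℝ≥0, Monotone t ∧ t 0 = 0 ∧ ∀ s ∈ I, ∃ k, t k = s := by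
  classical
  set J := insert 0 I with hJ
  have hpos : 0 < J.card := Finset.card_pos.2 ⟨0, by simp [hJ]⟩
  let e := J.orderEmbOfFin rfl
  refine ⟨fun k => e ⟨min k (J.card - 1), by omega⟩, ?_, ?_, ?_⟩
  · intro a b hab
    apply e.monotone
    rw [Fin.mk_le_mk]
    omega
  · have h0 : (0 : ℝ≥0) ∈ Set.range e := by
      simp [e, hJ]
    obtain ⟨i, hi⟩ := h0
    apply le_antisymm _ zero_le
    rw [← hi]
    apply e.monotone
    rw [Fin.le_def]
    simp
  · intro s hs
    have h0 : s ∈ Set.range e := by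
      simp [e, hJ, hs]
    obtain ⟨i, hi⟩ := h0
    refine ⟨i, ?_⟩
    rw [← hi]
    exact congrArg e (Fin.ext (min_eq_left (Nat.le_sub_one_of_lt i.2)))

variable {Ω : Type*} [mΩ : MeasurableSpace Ω] {P : Measure Ω} {X : ℝ≥0 → Ω → ℝ}

/-- The past of a process with independent increments is independent of its future increments. -/
theorem indepFun_past_future [IsProbabilityMeasure P] (hm : ∀ t, Measurable (X t))
    (hX : HasIndepIncrements X P) (r : ℝ≥0) :
    IndepFun (fun ω (s : ℝ≥0) => X (min s r) ω - X 0 ω)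
      (fun ω (s : ℝ≥0) => X (r + s) ω - X r ω) P := by
  classical
  refine IndepFun.process_indepFun_process (X := fun s ω => X (min s r) ω - X 0 ω)
    (Y := fun s ω => X (r + s) ω - X r ω) (fun s => (hm _).sub (hm _))
    (fun s => (hm _).sub (hm _)) fun I J => ?_
  obtain ⟨t, ht, ht0, htI⟩ := exists_monotone_seq_of_finset
    (insert r (I.image (fun s => min s r) ∪ J.image (fun s => r + s)))
  obtain ⟨n, hn⟩ := htI r (by simp)
  have hk : ∀ s : I, ∃ k ≤ n, t k = min s.1 r := by
    intro s
    obtain ⟨k, hk⟩ := htI (min s.1 r) (by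
      simp only [Finset.mem_insert, Finset.mem_union, Finset.mem_image]
      exact Or.inr (Or.inl ⟨s.1, s.2, rfl⟩))
    -- The sequence may repeat values; an index past `n` then has value `r`, and `n` replaces it.
    rcases le_total k n with h | h
    · exact ⟨k, h, hk⟩
    · refine ⟨n, le_rfl, le_antisymm (hk ▸ ht h) (hn ▸ min_le_right _ _)⟩
  have hl : ∀ s : J, ∃ k, n ≤ k ∧ t k = r + s.1 := by
    intro s
    obtain ⟨k, hk⟩ := htI (r + s.1) (by
      simp only [Finset.mem_insert, Finset.mem_union, Finset.mem_image]
      exact Or.inr (Or.inr ⟨s.1, s.2, rfl⟩))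
    rcases le_total n k with h | h
    · exact ⟨k, h, hk⟩
    · refine ⟨n, le_rfl, le_antisymm (hn ▸ le_self_add) (hk ▸ ht h)⟩
  choose k hkn hk using hk
  choose l hln hl using hl
  set N := Finset.univ.sup l with hN
  have hlN : ∀ s, l s ≤ N := fun s => Finset.le_sup (Finset.mem_univ s)
  have hdisj : Disjoint (Finset.range n) (Finset.Ico n N) := by
    rw [Finset.disjoint_left]
    intro a ha hb
    simp at ha hb
    omega
  -- Past and future values are sums of increments over two disjoint blocks of indices, before and
  -- after `n`.
  have hind := (hX.nat ht).indepFun_finset (Finset.range n) (Finset.Ico n N) hdisj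
    (fun i => (hm _).sub (hm _))
  have h2 := hind.comp
    (φ := fun x (s : I) => ∑ j : Finset.range n, if (j : ℕ) < k s then x j else 0)
    (ψ := fun x (s : J) => ∑ j : Finset.Ico n N, if (j : ℕ) < l s then x j else 0)
    (measurable_pi_lambda _ fun s => Finset.measurable_sum _ fun j _ => by
      split_ifs <;> fun_prop)
    (measurable_pi_lambda _ fun s => Finset.measurable_sum _ fun j _ => by
      split_ifs <;> fun_prop)
  convert h2 using 1
  · ext ω s
    simp only [Function.comp]
    rw [Finset.sum_coe_sort (Finset.range n)
      (fun j => if j < k s then X (t (j + 1)) ω - X (t j) ω else 0), ← Finset.sum_filter]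
    have : (Finset.range n).filter (fun j => j < k s) = Finset.range (k s) := by
      ext j
      have := hkn s
      simp
      omega
    rw [this, Finset.sum_range_sub (fun j => X (t j) ω), hk, ht0]
  · ext ω s
    simp only [Function.comp]
    rw [Finset.sum_coe_sort (Finset.Ico n N)
      (fun j => if j < l s then X (t (j + 1)) ω - X (t j) ω else 0), ← Finset.sum_filter]
    have : (Finset.Ico n N).filter (fun j => j < l s) = Finset.Ico n (l s) := by
      ext j
      have := hlN s
      simp
      omega
    rw [this, Finset.sum_Ico_eq_sub _ (hln s), Finset.sum_range_sub (fun j => X (t j) ω),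
      Finset.sum_range_sub (fun j => X (t j) ω), hl, ht0, hn]
    ring

/-! ### σ-algebras of the path up to a given time -/

/-- The σ-algebra of the path up to time `t` is generated by the stopped path. -/
theorem naturalSigma_eq_comap_stopped {Ω : Type*} (Y : ℝ≥0 → Ω → ℝ) (t : ℝ≥0) :
    naturalSigma Y t = MeasurableSpace.comap (fun ω (s : ℝ≥0) => Y (min s t) ω)
      MeasurableSpace.pi := by
  unfold naturalSigma MeasurableSpace.pi
  simp only [MeasurableSpace.comap_iSup, MeasurableSpace.comap_comp]
  apply le_antisymm
  · refine iSup₂_le fun s hs => ?_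
    refine le_trans (le_of_eq ?_) (le_iSup _ s)
    congr 1
    ext ω
    simp [min_eq_left hs]
  · refine iSup_le fun s => ?_
    exact le_iSup₂_of_le (min s t) (min_le_right _ _) le_rfl

/-- The σ-algebra of the path up to time `t` is the preimage of the one on the path space. -/
theorem naturalSigma_eq_comap_path {Ω : Type*} (Y : ℝ≥0 → Ω → ℝ) (t : ℝ≥0) :
    naturalSigma Y t = MeasurableSpace.comap (fun ω s => Y s ω)
      (naturalSigma (fun s (x : ℝ≥0 → ℝ) => x s) t) := by
  unfold naturalSigma
  simp only [MeasurableSpace.comap_iSup, MeasurableSpace.comap_comp]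
  rfl

theorem naturalSigma_mono {Ω : Type*} (Y : ℝ≥0 → Ω → ℝ) : Monotone (naturalSigma Y) := by
  intro s t hst
  exact iSup₂_le fun r hr => le_iSup₂_of_le r (hr.trans hst) le_rfl

theorem naturalSigma_le (hm : ∀ t, Measurable (X t)) (t : ℝ≥0) : naturalSigma X t ≤ mΩ :=
  iSup₂_le fun s _ => (hm s).comap_le

theorem pathSigma_le (t : ℝ≥0) :
    naturalSigma (fun s (x : ℝ≥0 → ℝ) => x s) t ≤ MeasurableSpace.pi :=
  naturalSigma_le (fun s => measurable_pi_apply s) t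

/-- Membership in an event that only depends on the path up to `t` is unchanged by stopping. -/
theorem mem_iff_stopped_mem {t : ℝ≥0} {B : Set (ℝ≥0 → ℝ)}
    (hB : MeasurableSet[naturalSigma (fun s (x : ℝ≥0 → ℝ) => x s) t] B) (x : ℝ≥0 → ℝ) :
    x ∈ B ↔ (fun s => x (min s t)) ∈ B := by
  rw [naturalSigma_eq_comap_stopped] at hB
  obtain ⟨D, -, rfl⟩ := hB
  simp

/-! ### Germ σ-algebra and zero-one law -/

theorem indep_naturalSigma_future [IsProbabilityMeasure P] (hm : ∀ t, Measurable (X t))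
    (h0 : ∀ᵐ ω ∂P, X 0 ω = 0) (hX : HasIndepIncrements X P) (r : ℝ≥0) :
    Indep (naturalSigma X r)
      (MeasurableSpace.comap (fun ω (s : ℝ≥0) => X (r + s) ω - X r ω) MeasurableSpace.pi) P := by
  rw [naturalSigma_eq_comap_stopped]
  refine (IndepFun_iff_Indep _ _ _).1 ((indepFun_past_future hm hX r).congr ?_ .rfl)
  filter_upwards [h0] with ω hω
  simp [hω]

/-- The increments after `t` are independent of the germ σ-algebra at `t`. -/
theorem indep_germ_future [IsProbabilityMeasure P] (hm : ∀ t, Measurable (X t))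
    (h0 : ∀ᵐ ω ∂P, X 0 ω = 0) (hX : HasIndepIncrements X P)
    (hrc : ∀ᵐ ω ∂P, ∀ t : ℝ≥0, ContinuousWithinAt (fun s => X s ω) (Set.Ioi t) t) (t : ℝ≥0) :
    Indep (⨅ u > t, naturalSigma X u)
      (MeasurableSpace.comap (fun ω (s : ℝ≥0) => X (t + s) ω - X t ω) MeasurableSpace.pi) P := by
  have hle : (⨅ u > t, naturalSigma X u) ≤ mΩ :=
    (iInf₂_le (t + 1) (by simp)).trans (naturalSigma_le hm _)
  refine indep_comap_process_of_bcf (X := fun s ω => X (t + s) ω - X t ω) hle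
    (fun s => ((hm _).sub (hm _)).aemeasurable) fun A hA I f => ?_
  obtain ⟨e, -, hepos, he⟩ := exists_seq_strictAnti_tendsto (0 : ℝ≥0)
  have hconv : ∀ᵐ ω ∂P, Tendsto
      (fun n => f fun s : I => X (t + e n + s.1) ω - X (t + e n) ω) atTop
      (𝓝 (f fun s : I => X (t + s.1) ω - X t ω)) := by
    filter_upwards [hrc] with ω hω
    have key : ∀ s : ℝ≥0, Tendsto (fun n => X (t + e n + s) ω) atTop (𝓝 (X (t + s) ω)) := by
      intro s
      refine (hω (t + s)).tendsto.comp (tendsto_nhdsWithin_iff.2 ⟨?_, ?_⟩)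
      · have : Tendsto (fun n => t + e n + s) atTop (𝓝 (t + 0 + s)) :=
          (tendsto_const_nhds.add he).add tendsto_const_nhds
        simpa using this
      · exact Eventually.of_forall fun n => by
          simpa using hepos n
    refine (f.continuous.tendsto _).comp (tendsto_pi_nhds.2 fun s => ?_)
    simpa using (key s.1).sub (key 0)
  have hfm : ∀ n, Measurable fun ω => f fun s : I => X (t + e n + s.1) ω - X (t + e n) ω :=
    fun n => f.continuous.measurable.comp
      (measurable_pi_lambda _ fun s => (hm _).sub (hm _))
  -- Used for `Q = P` restricted to `A` and for `Q = P`: the product formula holds for increments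
  -- after `t + e n`, and right-continuity carries it to the limit.
  have hlim : ∀ Q : Measure Ω, IsFiniteMeasure Q → Q ≪ P →
      Tendsto (fun n => ∫ ω, f (fun s : I => X (t + e n + s.1) ω - X (t + e n) ω) ∂Q) atTop
        (𝓝 (∫ ω, f (fun s : I => X (t + s.1) ω - X t ω) ∂Q)) := by
    intro Q _ hQ
    refine tendsto_integral_of_dominated_convergence (fun _ => ‖f‖)
      (fun n => (hfm n).aestronglyMeasurable) (integrable_const _)
      (fun n => Eventually.of_forall fun ω => f.norm_coe_le_norm _) (hQ hconv)
  have h1 := hlim (P.restrict A) inferInstance Measure.absolutelyContinuous_restrict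
  have h2 := (hlim P inferInstance .rfl).const_mul (P.real A)
  refine tendsto_nhds_unique h1 (h2.congr fun n => ?_)
  have hAm : MeasurableSet[naturalSigma X (t + e n)] A := by
    have h : (⨅ u > t, naturalSigma X u) ≤ naturalSigma X (t + e n) :=
      iInf₂_le (t + e n) (by simpa using hepos n)
    exact h A hA
  have hind := indep_naturalSigma_future hm h0 hX (t + e n)
  have hif : IndepFun (A.indicator (fun _ => (1 : ℝ)))
      (fun ω (s : ℝ≥0) => X (t + e n + s) ω - X (t + e n) ω) P := by
    rw [IndepFun_iff_Indep]
    refine indep_of_indep_of_le_left hind ?_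
    exact (measurable_const.indicator hAm : Measurable[naturalSigma X (t + e n)] _).comap_le
  have hif2 := hif.comp (φ := id) (ψ := fun x => f fun s : I => x s.1) measurable_id
    (f.continuous.measurable.comp (measurable_pi_lambda _ fun s => measurable_pi_apply _))
  have h3 := hif2.integral_mul_eq_mul_integral
    (measurable_const.indicator (hle A hA)).aestronglyMeasurable (hfm n).aestronglyMeasurable
  have h4 : P.real A = ∫ ω, A.indicator (fun _ => (1 : ℝ)) ω ∂P := by
    rw [integral_indicator (hle A hA)]
    simp
  rw [h4]
  refine h3.symm.trans ?_
  rw [← integral_indicator (hle A hA)]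
  congr 1
  ext ω
  by_cases h : ω ∈ A <;> simp [h]

/-- **Blumenthal's zero-one law** for a right-continuous process with independent increments:
modulo null sets the germ σ-algebra at `t` is contained in the σ-algebra of the past. -/
theorem exists_measurableSet_naturalSigma_ae_eq [IsProbabilityMeasure P]
    (hm : ∀ t, Measurable (X t))
    (h0 : ∀ᵐ ω ∂P, X 0 ω = 0) (hX : HasIndepIncrements X P)
    (hrc : ∀ᵐ ω ∂P, ∀ t : ℝ≥0, ContinuousWithinAt (fun s => X s ω) (Set.Ioi t) t) (t : ℝ≥0)
    {A : Set Ω} (hA : ∀ u > t, MeasurableSet[naturalSigma X u] A) :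
    ∃ C, MeasurableSet[naturalSigma X t] C ∧ A =ᵐ[P] C := by
  set V : Ω → ℝ≥0 → ℝ := fun ω s => X (min s t) ω with hV
  set W : Ω → ℝ≥0 → ℝ := fun ω s => X (t + s) ω - X t ω with hW
  have hAm : MeasurableSet A := naturalSigma_le hm _ A (hA (t + 1) (by simp))
  have hVm : Measurable V := measurable_pi_lambda _ fun s => hm _
  have hWm : Measurable W := measurable_pi_lambda _ fun s => (hm _).sub (hm _)
  have hVle : MeasurableSpace.comap V MeasurableSpace.pi ≤ ⨅ u > t, naturalSigma X u := by
    rw [hV, ← naturalSigma_eq_comap_stopped]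
    exact le_iInf₂ fun u hu => naturalSigma_mono X hu.le
  have hAg : MeasurableSet[⨅ u > t, naturalSigma X u] A := by
    simp only [MeasurableSpace.measurableSet_iInf]
    exact hA
  have hVA : Measurable fun ω => (V ω, ω ∈ A) := hVm.prodMk (measurable_mem.2 hAm)
  have hind : IndepFun (fun ω => (V ω, ω ∈ A)) W P := by
    rw [IndepFun_iff_Indep]
    refine indep_of_indep_of_le_left (indep_germ_future hm h0 hX hrc t) ?_
    refine Measurable.comap_le ?_
    exact Measurable.prodMk (m := ⨅ u > t, naturalSigma X u)
      (measurable_iff_comap_le.2 hVle)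
      (@measurable_mem Ω A (⨅ u > t, naturalSigma X u) |>.2 hAg)
  obtain ⟨B, hB, hBA⟩ : ∃ B : Set ((ℝ≥0 → ℝ) × (ℝ≥0 → ℝ)), MeasurableSet B ∧
      ∀ ω, ω ∈ A ↔ (V ω, W ω) ∈ B := by
    have h1 := hA (t + 1) (by simp)
    rw [naturalSigma_eq_comap_path] at h1
    obtain ⟨D, hD, rfl⟩ := h1
    -- The path is rebuilt from its past and its increments after `t`.
    refine ⟨(fun p s => if s ≤ t then p.1 s else p.1 t + p.2 (s - t)) ⁻¹' D, ?_, ?_⟩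
    · refine (measurable_pi_lambda _ fun s => ?_) (pathSigma_le _ D hD)
      split_ifs <;> fun_prop
    · intro ω
      simp only [Set.mem_preimage]
      convert Iff.rfl using 2
      ext s
      split_ifs with h
      · simp [hV, h]
      · simp [hV, hW, add_tsub_cancel_of_le (not_le.1 h).le]
  have hlaw := hind.map_prod_eq_prod_map_map hVA.aemeasurable hWm.aemeasurable
  have hset : MeasurableSet {q : ((ℝ≥0 → ℝ) × Prop) × (ℝ≥0 → ℝ) | q.1.2 ↔ (q.1.1, q.2) ∈ B} := by
    have h1 : Measurable fun q : ((ℝ≥0 → ℝ) × Prop) × (ℝ≥0 → ℝ) => q.1.2 := by fun_prop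
    have h2 : Measurable fun q : ((ℝ≥0 → ℝ) × Prop) × (ℝ≥0 → ℝ) => (q.1.1, q.2) ∈ B :=
      measurable_mem.2 ((by fun_prop : Measurable
        fun q : ((ℝ≥0 → ℝ) × Prop) × (ℝ≥0 → ℝ) => (q.1.1, q.2)) hB)
    exact (h1.iff h2).setOf
  have hae : ∀ᵐ q ∂((P.map fun ω => (V ω, ω ∈ A)).prod (P.map W)),
      q.1.2 ↔ (q.1.1, q.2) ∈ B := by
    rw [← hlaw, ae_map_iff (hVA.prodMk hWm).aemeasurable hset]
    exact Eventually.of_forall hBA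
  have : IsProbabilityMeasure (P.map W) := Measure.isProbabilityMeasure_map hWm.aemeasurable
  have hfub := ae_of_ae_map hVA.aemeasurable (Measure.ae_ae_of_ae_prod hae)
  -- Since `(V, 1_A)` is independent of `W`, for almost every `ω` the section of `B` at `V ω` has
  -- `W`-probability 1 or 0, according to whether `ω ∈ A`.
  refine ⟨V ⁻¹' {v | P.map W (Prod.mk v ⁻¹' B) = 1}, ?_, ?_⟩
  · rw [naturalSigma_eq_comap_stopped]
    exact ⟨_, measurable_measure_prodMk_left hB (measurableSet_singleton 1), rfl⟩
  · rw [eventuallyEq_set]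
    filter_upwards [hfub] with ω hω
    simp only [Set.mem_preimage, Set.mem_ofPred_eq]
    constructor
    · intro h
      simp only [h, true_iff] at hω
      exact prob_compl_eq_zero_iff (measurable_prodMk_left hB) |>.1 hω
    · intro h
      by_contra hn
      simp only [hn, false_iff] at hω
      have : P.map W (Prod.mk (V ω) ⁻¹' B) = 0 := by
        rw [measure_eq_zero_iff_ae_notMem]
        exact hω
      rw [this] at h
      exact zero_ne_one h

/-! ### Laplace exponent and uniqueness of Laplace transforms -/

/-- The Laplace exponent of the standard gamma process. -/
noncomputable def laplaceExponent (l : ℝ) : ℝ :=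
  ∫ x in Set.Ioi (0 : ℝ), (1 - Real.exp (-(l * x))) * (Real.exp (-x) / x)

theorem integrableOn_laplaceExponent {l : ℝ} (hl : 0 ≤ l) :
    IntegrableOn (fun x : ℝ => (1 - Real.exp (-(l * x))) * (Real.exp (-x) / x)) (Set.Ioi 0) := by
  have h1 : IntegrableOn (fun x : ℝ => l * Real.exp (-x)) (Set.Ioi 0) :=
    (integrableOn_exp_neg_Ioi 0).const_mul l
  refine h1.mono' (by fun_prop) ?_
  filter_upwards [ae_restrict_mem measurableSet_Ioi] with x hx
  have hx : 0 < x := hx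
  have h2 : 0 ≤ 1 - Real.exp (-(l * x)) := by
    have : Real.exp (-(l * x)) ≤ 1 := Real.exp_le_one_iff.2 (by nlinarith)
    linarith
  have h3 : 1 - Real.exp (-(l * x)) ≤ l * x := by
    have := Real.add_one_le_exp (-(l * x))
    linarith
  rw [Real.norm_of_nonneg (by positivity)]
  calc (1 - Real.exp (-(l * x))) * (Real.exp (-x) / x)
      ≤ (l * x) * (Real.exp (-x) / x) := by gcongr
    _ = l * Real.exp (-x) := by field_simp

/-- The difference `ψ(a + b) - ψ(a)` has integrand `(1 - e^{-bx}) e^{-(1+a)x} / x`; substitute `y =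
(1 + a) x`, which leaves `dx / x` invariant. This is the functional equation of `log (1 + l)`, and
it replaces the closed form. -/
theorem laplaceExponent_add {a b : ℝ} (ha : 0 ≤ a) (hb : 0 ≤ b) :
    laplaceExponent (a + b) = laplaceExponent a + laplaceExponent (b / (1 + a)) := by
  have hpos : 0 < 1 + a := by linarith
  rw [← sub_eq_iff_eq_add']
  unfold laplaceExponent
  rw [← integral_sub (integrableOn_laplaceExponent (by positivity))
    (integrableOn_laplaceExponent ha)]
  have h1 := integral_comp_mul_left_Ioi
    (fun x : ℝ => (1 - Real.exp (-(b / (1 + a) * x))) * (Real.exp (-x) / x)) 0 hpos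
  rw [mul_zero, smul_eq_mul, eq_inv_mul_iff_mul_eq₀ hpos.ne', ← integral_const_mul] at h1
  rw [← h1]
  refine setIntegral_congr_fun measurableSet_Ioi fun x hx => ?_
  have hx : 0 < x := hx
  have e1 : -(b / (1 + a) * ((1 + a) * x)) = -(b * x) := by field_simp
  have e2 : -((1 + a) * x) = -x + -(a * x) := by ring
  have e3 : -((a + b) * x) = -(a * x) + -(b * x) := by ring
  simp only [e1, e2, e3, Real.exp_add]
  field_simp
  ring

theorem laplaceExponent_one_pos : 0 < laplaceExponent 1 := by
  unfold laplaceExponent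
  have hp : ∀ x ∈ Set.Ioi (0 : ℝ), 0 < (1 - Real.exp (-(1 * x))) * (Real.exp (-x) / x) := by
    intro x hx
    have hx : 0 < x := hx
    have h2 : 0 < 1 - Real.exp (-(1 * x)) := by
      have : Real.exp (-(1 * x)) < 1 := Real.exp_lt_one_iff.2 (by linarith)
      linarith
    positivity
  rw [setIntegral_pos_iff_support_of_nonneg_ae _ (integrableOn_laplaceExponent zero_le_one)]
  · have : (Function.support fun x : ℝ => (1 - Real.exp (-(1 * x))) * (Real.exp (-x) / x)) ∩
        Set.Ioi 0 = Set.Ioi 0 :=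
      Set.inter_eq_right.2 fun x hx => (hp x hx).ne'
    rw [this]
    simp
  · filter_upwards [ae_restrict_mem measurableSet_Ioi] with x hx using (hp x hx).le

/-- Take `a = 2 ^ n - 1` and `b = 2 ^ n`, so that `b / (1 + a) = 1`. This shows that the exponent is
unbounded. -/
theorem laplaceExponent_two_pow (n : ℕ) :
    laplaceExponent (2 ^ n - 1) = n * laplaceExponent 1 := by
  induction n with
  | zero => simp [laplaceExponent]
  | succ n ih =>
    have h1 : (1 : ℝ) ≤ 2 ^ n := one_le_pow₀ (by norm_num)
    have h := laplaceExponent_add (a := 2 ^ n - 1) (b := 2 ^ n) (by linarith) (by positivity)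
    have e1 : (2 : ℝ) ^ n - 1 + 2 ^ n = 2 ^ (n + 1) - 1 := by ring
    have e2 : (2 : ℝ) ^ n / (1 + (2 ^ n - 1)) = 1 := by
      rw [add_sub_cancel]; exact div_self (by positivity)
    rw [e1, e2, ih] at h
    rw [h]
    push_cast
    ring

/-- Finite measures on `[0, ∞)` are determined by their Laplace transforms at the integers. -/
theorem measure_eq_of_laplace_nnreal {μ ν : Measure ℝ≥0} [IsFiniteMeasure μ] [IsFiniteMeasure ν]
    (h : ∀ k : ℕ, ∫ x : ℝ≥0, Real.exp (-(k * (x : ℝ))) ∂μ =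
      ∫ x : ℝ≥0, Real.exp (-(k * (x : ℝ))) ∂ν) : μ = ν := by
  let e : BoundedContinuousFunction ℝ≥0 ℝ := BoundedContinuousFunction.ofNormedAddCommGroup
    (fun x : ℝ≥0 => Real.exp (-(x : ℝ))) (by fun_prop) 1 (fun x => by
      rw [Real.norm_of_nonneg (Real.exp_pos _).le]
      exact Real.exp_le_one_iff.2 (by simp))
  have he : ∀ x, e x = Real.exp (-(x : ℝ)) := fun x => rfl
  -- Polynomials in `e^{-x}` form an algebra separating points, and their integrals are combinations
  -- of Laplace transforms at integers.
  let A : StarSubalgebra ℝ (BoundedContinuousFunction ℝ≥0 ℝ) :=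
    { (Polynomial.aeval e).range with
      star_mem' := by
        rintro a ⟨p, rfl⟩
        refine ⟨p, ?_⟩
        ext x
        simp }
  have hA : ∀ g, g ∈ A ↔ ∃ p : Polynomial ℝ, Polynomial.aeval e p = g := fun g => Iff.rfl
  refine ext_of_forall_mem_subalgebra_integral_eq_of_pseudoEMetric_complete_countable
    (𝕜 := ℝ) (A := A) ?_ ?_
  · intro x y hxy
    refine ⟨e, ⟨BoundedContinuousFunction.toContinuousMapStarₐ ℝ e,
      ⟨e, (hA e).2 ⟨Polynomial.X, by simp⟩, rfl⟩, rfl⟩, ?_⟩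
    rw [he, he]
    intro h
    have := Real.exp_injective h
    exact hxy (NNReal.coe_injective (neg_injective this))
  · intro g hg
    obtain ⟨p, rfl⟩ := (hA g).1 hg
    induction p using Polynomial.induction_on' with
    | add p q hp hq =>
      simp only [map_add, BoundedContinuousFunction.coe_add, Pi.add_apply]
      rw [integral_add, integral_add, hp ((hA _).2 ⟨p, rfl⟩), hq ((hA _).2 ⟨q, rfl⟩)]
      all_goals exact BoundedContinuousFunction.integrable _ _
    | monomial n a =>
      have : ∀ x, (Polynomial.aeval e (Polynomial.monomial n a)) x =
          a * Real.exp (-(n * (x : ℝ))) := by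
        intro x
        rw [Polynomial.aeval_monomial]
        simp [he, ← Real.exp_nat_mul]
      simp only [this]
      rw [integral_const_mul, integral_const_mul, h]

/-- Transport to the half-line, where `e^{-x}` is bounded. -/
theorem measure_eq_of_laplace {μ ν : Measure ℝ} [IsFiniteMeasure μ] [IsFiniteMeasure ν]
    (hμ : ∀ᵐ x ∂μ, 0 ≤ x) (hν : ∀ᵐ x ∂ν, 0 ≤ x)
    (h : ∀ k : ℕ, ∫ x, Real.exp (-(k * x)) ∂μ = ∫ x, Real.exp (-(k * x)) ∂ν) : μ = ν := by
  have key : ∀ ρ : Measure ℝ, (∀ᵐ x ∂ρ, 0 ≤ x) →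
      (ρ.map Real.toNNReal).map ((↑) : ℝ≥0 → ℝ) = ρ ∧
      ∀ k : ℕ, ∫ x : ℝ≥0, Real.exp (-(k * (x : ℝ))) ∂(ρ.map Real.toNNReal) =
        ∫ x, Real.exp (-(k * x)) ∂ρ := by
    intro ρ hρ
    constructor
    · rw [Measure.map_map (by fun_prop) (by fun_prop)]
      conv_rhs => rw [← Measure.map_id (μ := ρ)]
      refine Measure.map_congr ?_
      filter_upwards [hρ] with x hx
      simp [hx]
    · intro k
      rw [integral_map (by fun_prop) (by fun_prop)]
      refine integral_congr_ae ?_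
      filter_upwards [hρ] with x hx
      simp [hx]
  have : μ.map Real.toNNReal = ν.map Real.toNNReal :=
    measure_eq_of_laplace_nnreal fun k => by rw [(key μ hμ).2, (key ν hν).2, h]
  rw [← (key μ hμ).1, this, (key ν hν).1]

/-! ### Positivity and strict monotonicity -/

variable {γ : ℝ≥0 → Ω → ℝ}

theorem IsSubordinator.ae_nonneg (hX : IsSubordinator X P) :
    ∀ᵐ ω ∂P, ∀ t, 0 ≤ X t ω := by
  filter_upwards [hX.zero, hX.monotone] with ω h0 hm t
  rw [← h0]
  exact hm zero_le

namespace IsStandardGammaProcess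

theorem integral_exp_neg (hγ : IsStandardGammaProcess γ P) (t : ℝ≥0) {l : ℝ} (hl : 0 ≤ l) :
    ∫ ω, Real.exp (-(l * γ t ω)) ∂P = Real.exp (-(t * laplaceExponent l)) :=
  hγ.laplace t l hl

theorem integrable_exp_neg [IsProbabilityMeasure P] (hγ : IsStandardGammaProcess γ P) (t : ℝ≥0)
    {l : ℝ} (hl : 0 ≤ l) : Integrable (fun ω => Real.exp (-(l * γ t ω))) P := by
  have := hγ.measurable t
  refine (integrable_const (1 : ℝ)).mono' (by fun_prop) ?_
  filter_upwards [hγ.toIsSubordinator.ae_nonneg] with ω hω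
  rw [Real.norm_of_nonneg (Real.exp_pos _).le]
  exact Real.exp_le_one_iff.2 (by have := mul_nonneg hl (hω t); linarith)

/-- For every `l ≥ 0`, `P(γ_h ≤ 0) ≤ E[exp (-l γ_h)] = exp (-h ψ(l))`; let `l = 2 ^ n - 1` grow. -/
theorem ae_pos [IsProbabilityMeasure P] (hγ : IsStandardGammaProcess γ P) {h : ℝ≥0}
    (hh : 0 < h) : ∀ᵐ ω ∂P, 0 < γ h ω := by
  have hms : MeasurableSet {ω | γ h ω ≤ 0} := measurableSet_le (hγ.measurable h) measurable_const
  have hb : ∀ n : ℕ, P.real {ω | γ h ω ≤ 0} ≤ Real.exp (-(h * laplaceExponent 1)) ^ n := by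
    intro n
    have h1 : (0 : ℝ) ≤ 2 ^ n - 1 := by
      have : (1 : ℝ) ≤ 2 ^ n := one_le_pow₀ (by norm_num)
      linarith
    have h2 := hγ.integral_exp_neg h h1
    rw [laplaceExponent_two_pow] at h2
    have h3 : Real.exp (-(h * laplaceExponent 1)) ^ n =
        Real.exp (-(h * (n * laplaceExponent 1))) := by
      rw [← Real.exp_nat_mul]
      congr 1
      ring
    rw [h3, ← h2]
    have h4 : P.real {ω | γ h ω ≤ 0} =
        ∫ ω, {ω | γ h ω ≤ 0}.indicator (fun _ => (1 : ℝ)) ω ∂P := by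
      rw [integral_indicator hms]
      simp
    rw [h4]
    refine integral_mono ((integrable_const _).indicator hms) (hγ.integrable_exp_neg h h1) ?_
    intro ω
    refine Set.indicator_apply_le' (fun hω => ?_) fun _ => (Real.exp_pos _).le
    refine Real.one_le_exp ?_
    have : γ h ω ≤ 0 := hω
    nlinarith
  have hlt : Real.exp (-(h * laplaceExponent 1)) < 1 := by
    rw [Real.exp_lt_one_iff]
    have := mul_pos (NNReal.coe_pos.2 hh) laplaceExponent_one_pos
    linarith
  have h0 : P.real {ω | γ h ω ≤ 0} ≤ 0 :=
    ge_of_tendsto' (tendsto_pow_atTop_nhds_zero_of_lt_one (Real.exp_pos _).le hlt) hb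
  have h00 : P {ω | γ h ω ≤ 0} = 0 := by
    rw [← measureReal_eq_zero_iff]
    exact le_antisymm h0 measureReal_nonneg
  rw [ae_iff]
  simpa using h00

theorem ae_increment_pos [IsProbabilityMeasure P] (hγ : IsStandardGammaProcess γ P) {s t : ℝ≥0}
    (hst : s < t) : ∀ᵐ ω ∂P, 0 < γ t ω - γ s ω := by
  have h := hγ.stationary s (t - s)
  rw [add_tsub_cancel_of_le hst.le] at h
  exact h.symm.ae_snd measurableSet_Ioi (hγ.ae_pos (tsub_pos_of_lt hst))

/-- Almost every path of the gamma process is strictly increasing. -/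
theorem ae_strictMono [IsProbabilityMeasure P] (hγ : IsStandardGammaProcess γ P) :
    ∀ᵐ ω ∂P, StrictMono fun t => γ t ω := by
  obtain ⟨D, hDc, hD⟩ := TopologicalSpace.exists_countable_dense ℝ≥0
  have h1 : ∀ᵐ ω ∂P, ∀ s ∈ D, ∀ t ∈ D, s < t → 0 < γ t ω - γ s ω :=
    (ae_ball_iff hDc).2 fun s _ => (ae_ball_iff hDc).2 fun t _ =>
      eventually_imp_distrib_left.2 fun hst => hγ.ae_increment_pos hst
  filter_upwards [h1, hγ.monotone] with ω hω hm s t hst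
  obtain ⟨q, hq, hsq, hqt⟩ := hD.exists_between hst
  obtain ⟨q', hq', hqq', hq't⟩ := hD.exists_between hqt
  have := hω q hq q' hq' hqq'
  have h2 := hm hsq.le
  have h3 := hm hq't.le
  simp only at h2 h3 ⊢
  linarith

/-! ### Exponential tilting and quasi-invariance -/

/-- Exponential tilting of the marginal laws of the gamma process is a scaling. -/
theorem map_withDensity_eq [IsProbabilityMeasure P] (hγ : IsStandardGammaProcess γ P) (h : ℝ≥0)
    {l : ℝ} (hl : 0 ≤ l) :
    (P.map (γ h)).withDensity
        (fun x => ENNReal.ofReal (Real.exp (h * laplaceExponent l - l * x))) =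
      P.map fun ω => γ h ω / (1 + l) := by
  have hm := hγ.measurable h
  have hpos : 0 < 1 + l := by linarith
  have hint : Integrable (fun x => Real.exp (h * laplaceExponent l - l * x)) (P.map (γ h)) := by
    rw [integrable_map_measure (by fun_prop) hm.aemeasurable]
    have := (hγ.integrable_exp_neg h hl).const_mul (Real.exp (h * laplaceExponent l))
    refine this.congr (Eventually.of_forall fun ω => ?_)
    simp only [Function.comp]
    rw [← Real.exp_add]
    ring_nf
  have hfin : IsFiniteMeasure ((P.map (γ h)).withDensity
      (fun x => ENNReal.ofReal (Real.exp (h * laplaceExponent l - l * x)))) :=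
    isFiniteMeasure_withDensity_ofReal hint.2
  have hprob : IsProbabilityMeasure (P.map fun ω => γ h ω / (1 + l)) :=
    Measure.isProbabilityMeasure_map (by fun_prop)
  refine measure_eq_of_laplace ?_ ?_ fun k => ?_
  · have h0 : ∀ᵐ x ∂(P.map (γ h)), 0 ≤ x := by
      rw [ae_map_iff hm.aemeasurable measurableSet_Ici]
      filter_upwards [hγ.toIsSubordinator.ae_nonneg] with ω hω using hω h
    exact (withDensity_absolutelyContinuous _ _).ae_le h0
  · rw [ae_map_iff (by fun_prop) measurableSet_Ici]
    filter_upwards [hγ.toIsSubordinator.ae_nonneg] with ω hω using div_nonneg (hω h) hpos.le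
  -- At `k` the two transforms are `exp (h ψ(l) - h ψ(l + k))` and `exp (-h ψ(k / (1 + l)))`, equal
  -- by `laplaceExponent_add`.
  · rw [integral_withDensity_eq_integral_toReal_smul (by fun_prop) (by simp),
      integral_map hm.aemeasurable (by fun_prop), integral_map (by fun_prop) (by fun_prop)]
    have e1 : ∀ ω, (ENNReal.ofReal (Real.exp (h * laplaceExponent l - l * γ h ω))).toReal •
        Real.exp (-(k * γ h ω)) =
        Real.exp (h * laplaceExponent l) * Real.exp (-((l + k) * γ h ω)) := by
      intro ω
      rw [ENNReal.toReal_ofReal (Real.exp_pos _).le, smul_eq_mul, ← Real.exp_add, ← Real.exp_add]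
      ring_nf
    have e2 : ∀ ω, Real.exp (-(k * (γ h ω / (1 + l)))) =
        Real.exp (-((k / (1 + l)) * γ h ω)) := by
      intro ω
      ring_nf
    simp only [e1, e2]
    rw [integral_const_mul, hγ.integral_exp_neg h (by positivity),
      hγ.integral_exp_neg h (by positivity), ← Real.exp_add,
      laplaceExponent_add hl (Nat.cast_nonneg k)]
    ring_nf

end IsStandardGammaProcess

/-- Finite measures on a product space agree if their finite-dimensional marginals do. -/
theorem measure_pi_ext {ι : Type*} {α : ι → Type*} [∀ i, MeasurableSpace (α i)]
    {μ ν : Measure (∀ i, α i)} [IsFiniteMeasure ν]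
    (h : ∀ I : Finset ι, μ.map I.restrict = ν.map I.restrict) : μ = ν :=
  IsProjectiveLimit.unique (P := fun I : Finset ι => ν.map I.restrict)
    (fun I => h I) (fun _ => rfl)

namespace IsStandardGammaProcess

theorem map_increment [IsProbabilityMeasure P] (hγ : IsStandardGammaProcess γ P) {s t : ℝ≥0}
    (hst : s ≤ t) : P.map (fun ω => γ t ω - γ s ω) = P.map (γ (t - s)) := by
  have h := hγ.stationary s (t - s)
  rw [add_tsub_cancel_of_le hst] at h
  exact h.map_eq

/-- Under exponential tilting, the increments of the gamma process along a sequence of times have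
the same joint law as those of the scaled process. -/
theorem map_increments_withDensity_eq [IsProbabilityMeasure P]
    (hγ : IsStandardGammaProcess γ P) {t : ℕ → ℝ≥0} (ht : Monotone t) (ht0 : t 0 = 0) (n : ℕ)
    {l : ℝ} (hl : 0 ≤ l) :
    (P.withDensity fun ω =>
        ENNReal.ofReal (Real.exp (t n * laplaceExponent l - l * γ (t n) ω))).map
        (fun ω (j : Fin n) => γ (t (j + 1)) ω - γ (t j) ω) =
      P.map fun ω (j : Fin n) => (γ (t (j + 1)) ω - γ (t j) ω) / (1 + l) := by
  have hm := hγ.measurable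
  have hΔm : ∀ j, Measurable fun ω => γ (t (j + 1)) ω - γ (t j) ω :=
    fun j => (hm _).sub (hm _)
  have hΔ : Measurable fun ω (j : Fin n) => γ (t (j + 1)) ω - γ (t j) ω :=
    measurable_pi_lambda _ fun j => hΔm j
  have hind : iIndepFun (fun (j : Fin n) ω => γ (t (j + 1)) ω - γ (t j) ω) P :=
    (hγ.indep.nat ht).precomp Fin.val_injective
  have hind2 : iIndepFun (fun (j : Fin n) ω => (γ (t (j + 1)) ω - γ (t j) ω) / (1 + l)) P :=
    hind.comp (fun _ x => x / (1 + l)) fun _ => by fun_prop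
  have hpi := (iIndepFun_iff_map_fun_eq_pi_map
    fun j : Fin n => ((hΔm j).div_const (1 + l)).aemeasurable).1 hind2
  rw [hpi]
  have hprob : ∀ j : Fin n, IsProbabilityMeasure
      (P.map fun ω => (γ (t (j + 1)) ω - γ (t j) ω) / (1 + l)) := fun j =>
    Measure.isProbabilityMeasure_map ((hΔm j).div_const _).aemeasurable
  symm
  refine Measure.pi_eq fun S hS => ?_
  have hbox : MeasurableSet ((fun ω (j : Fin n) => γ (t (j + 1)) ω - γ (t j) ω) ⁻¹'
      Set.univ.pi S) :=
    hΔ (MeasurableSet.univ_pi hS)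
  let h : Fin n → ℝ≥0 := fun j => t (j + 1) - t j
  let g : Fin n → ℝ → ℝ≥0∞ := fun j => (S j).indicator fun x =>
    ENNReal.ofReal (Real.exp (h j * laplaceExponent l - l * x))
  have hg : ∀ j, Measurable (g j) := fun j => Measurable.indicator (by fun_prop) (hS j)
  rw [Measure.map_apply hΔ (MeasurableSet.univ_pi hS),
    withDensity_apply _ hbox, ← lintegral_indicator hbox]
  -- Both `t n` and `γ (t n)` telescope, so the density is a product over increments, and
  -- independence reduces the claim to one increment.
  have hprod : ∀ᵐ ω ∂P, ((fun ω (j : Fin n) => γ (t (j + 1)) ω - γ (t j) ω) ⁻¹'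
      Set.univ.pi S).indicator (fun ω =>
        ENNReal.ofReal (Real.exp (t n * laplaceExponent l - l * γ (t n) ω))) ω =
      ∏ j : Fin n, g j (γ (t (j + 1)) ω - γ (t j) ω) := by
    filter_upwards [hγ.zero] with ω h0
    by_cases hω : ∀ j : Fin n, γ (t (j + 1)) ω - γ (t j) ω ∈ S j
    · rw [Set.indicator_of_mem (by simpa using hω)]
      have e1 : ∀ j : Fin n, g j (γ (t (j + 1)) ω - γ (t j) ω) = ENNReal.ofReal
          (Real.exp (h j * laplaceExponent l - l * (γ (t (j + 1)) ω - γ (t j) ω))) :=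
        fun j => Set.indicator_of_mem (hω j) _
      simp only [e1]
      rw [← ENNReal.ofReal_prod_of_nonneg fun j _ => (Real.exp_pos _).le, ← Real.exp_sum,
        Finset.sum_sub_distrib, ← Finset.sum_mul, ← Finset.mul_sum,
        Fin.sum_univ_eq_sum_range (fun j => γ (t (j + 1)) ω - γ (t j) ω),
        Finset.sum_range_sub (fun j => γ (t j) ω), ht0, h0, sub_zero]
      have e2 : ∀ j : Fin n, ((h j : ℝ≥0) : ℝ) = (t (j + 1) : ℝ) - t j := fun j =>
        NNReal.coe_sub (ht (Nat.le_succ _))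
      simp only [e2]
      rw [Fin.sum_univ_eq_sum_range (fun j => (t (j + 1) : ℝ) - t j),
        Finset.sum_range_sub (fun j => (t j : ℝ)), ht0]
      simp
    · rw [Set.indicator_of_notMem (by simpa using hω)]
      push Not at hω
      obtain ⟨j, hj⟩ := hω
      symm
      exact Finset.prod_eq_zero (Finset.mem_univ j) (Set.indicator_of_notMem hj _)
  rw [lintegral_congr_ae hprod]
  have hindg : iIndepFun (fun (j : Fin n) ω => g j (γ (t (j + 1)) ω - γ (t j) ω)) P :=
    hind.comp g hg
  rw [lintegral_prod_eq_prod_lintegral_of_indepFun Finset.univ _ hindg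
    fun j => (hg j).comp (hΔm j)]
  refine Finset.prod_congr rfl fun j _ => ?_
  have e3 := hγ.map_increment (ht (Nat.le_succ (j : ℕ)))
  have e4 : P.map (fun ω => (γ (t (j + 1)) ω - γ (t j) ω) / (1 + l)) =
      P.map fun ω => γ (h j) ω / (1 + l) := by
    have hd : Measurable fun x : ℝ => x / (1 + l) := by fun_prop
    have a1 := Measure.map_map (μ := P) hd (hΔm j)
    have a2 := Measure.map_map (μ := P) hd (hm (h j))
    rw [e3] at a1
    exact a1.symm.trans a2
  rw [e4, ← hγ.map_withDensity_eq (h j) hl, withDensity_apply _ (hS j),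
    ← lintegral_indicator (hS j), ← e3, lintegral_map (hg j) (hΔm j)]

/-- **Quasi-invariance** of the gamma process: exponential tilting up to time `u` amounts to
scaling the stopped path. -/
theorem map_stopped_withDensity_eq [IsProbabilityMeasure P]
    (hγ : IsStandardGammaProcess γ P) (u : ℝ≥0) {l : ℝ} (hl : 0 ≤ l) :
    (P.withDensity fun ω =>
        ENNReal.ofReal (Real.exp (u * laplaceExponent l - l * γ u ω))).map
        (fun ω (s : ℝ≥0) => γ (min s u) ω) =
      P.map fun ω (s : ℝ≥0) => γ (min s u) ω / (1 + l) := by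
  classical
  have hm := hγ.measurable
  have hp1 : Measurable fun ω (s : ℝ≥0) => γ (min s u) ω := measurable_pi_lambda _ fun s => hm _
  have hp2 : Measurable fun ω (s : ℝ≥0) => γ (min s u) ω / (1 + l) :=
    measurable_pi_lambda _ fun s => (hm _).div_const _
  refine measure_pi_ext fun I => ?_
  rw [Measure.map_map (Finset.measurable_restrict I) hp1,
    Measure.map_map (Finset.measurable_restrict I) hp2]
  obtain ⟨t, ht, ht0, htI⟩ := exists_monotone_seq_of_finset
    (insert u (I.image (fun s => min s u)))
  obtain ⟨n, hn⟩ := htI u (by simp)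
  have hk : ∀ s : I, ∃ k ≤ n, t k = min s.1 u := by
    intro s
    obtain ⟨k, hk⟩ := htI (min s.1 u) (by
      simp only [Finset.mem_insert, Finset.mem_image]
      exact Or.inr ⟨s.1, s.2, rfl⟩)
    rcases le_total k n with h | h
    · exact ⟨k, h, hk⟩
    · exact ⟨n, le_rfl, le_antisymm (hk ▸ ht h) (hn ▸ min_le_right _ _)⟩
  choose k hkn hk using hk
  let G : (Fin n → ℝ) → I → ℝ := fun x s => ∑ j : Fin n, if (j : ℕ) < k s then x j else 0
  have hG : Measurable G := measurable_pi_lambda _ fun s => Finset.measurable_sum _ fun j _ => by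
    split_ifs <;> fun_prop
  have hsum : ∀ (y : ℕ → ℝ) (s : I),
      G (fun j => y (j + 1) - y j) s = y (k s) - y 0 := by
    intro y s
    simp only [G]
    rw [Fin.sum_univ_eq_sum_range (fun j => if j < k s then y (j + 1) - y j else 0),
      ← Finset.sum_filter]
    have : (Finset.range n).filter (fun j => j < k s) = Finset.range (k s) := by
      ext j
      have := hkn s
      simp
      omega
    rw [this, Finset.sum_range_sub]
  have hinc := congrArg (Measure.map G) (hγ.map_increments_withDensity_eq ht ht0 n hl)
  have hd1 : Measurable fun ω (j : Fin n) => γ (t (j + 1)) ω - γ (t j) ω :=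
    measurable_pi_lambda _ fun j => (hm _).sub (hm _)
  have hd2 : Measurable fun ω (j : Fin n) => (γ (t (j + 1)) ω - γ (t j) ω) / (1 + l) :=
    measurable_pi_lambda _ fun j => ((hm _).sub (hm _)).div_const _
  rw [Measure.map_map hG hd1, Measure.map_map hG hd2, hn] at hinc
  refine (Measure.map_congr ?_).trans (hinc.trans (Measure.map_congr ?_))
  · refine (withDensity_absolutelyContinuous _ _).ae_le ?_
    have : ∀ᵐ ω ∂P, (I.restrict ∘ fun ω s => γ (min s u) ω) ω =
        (G ∘ fun ω (j : Fin n) => γ (t (j + 1)) ω - γ (t j) ω) ω := by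
      filter_upwards [hγ.zero] with ω h0
      ext s
      simp only [Function.comp, Finset.restrict]
      rw [hsum (fun j => γ (t j) ω) s, hk, ht0, h0, sub_zero]
    exact this
  · filter_upwards [hγ.zero] with ω h0
    ext s
    simp only [Function.comp, Finset.restrict, sub_div]
    rw [hsum (fun j => γ (t j) ω / (1 + l)) s, hk, ht0, h0, zero_div, sub_zero]

/-- The laws of the scaled stopped paths are absolutely continuous with respect to the law of the
stopped path. -/
theorem ae_scaled_stopped_notMem [IsProbabilityMeasure P] (hγ : IsStandardGammaProcess γ P)
    (u : ℝ≥0) {c : ℝ} (hc : 0 < c) {B : Set (ℝ≥0 → ℝ)} (hB : MeasurableSet B)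
    (hnull : ∀ᵐ ω ∂P, (fun s => γ (min s u) ω) ∉ B) :
    ∀ᵐ ω ∂P, (fun s => γ (min s u) ω / c) ∉ B := by
  have hm := hγ.measurable
  have hp1 : Measurable fun ω (s : ℝ≥0) => γ (min s u) ω := measurable_pi_lambda _ fun s => hm _
  have hp2 : ∀ a : ℝ, Measurable fun ω (s : ℝ≥0) => γ (min s u) ω / a :=
    fun a => measurable_pi_lambda _ fun s => (hm _).div_const _
  rcases le_total 1 c with h1 | h1
  · have h := hγ.map_stopped_withDensity_eq u (l := c - 1) (by linarith)
    rw [add_sub_cancel] at h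
    have h2 : ∀ᵐ x ∂(P.map fun ω (s : ℝ≥0) => γ (min s u) ω / c), x ∉ B := by
      rw [← h, ae_map_iff hp1.aemeasurable hB.compl]
      exact (withDensity_absolutelyContinuous _ _).ae_le hnull
    rwa [ae_map_iff (hp2 c).aemeasurable hB.compl] at h2
  -- For `c ≤ 1`, run the tilting for `c⁻¹` backwards: its density is positive, so `P` is absolutely
  -- continuous with respect to the tilted measure.
  · have h1' : 1 ≤ c⁻¹ := (one_le_inv₀ hc).2 h1
    have h := hγ.map_stopped_withDensity_eq u (l := c⁻¹ - 1) (by linarith)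
    rw [add_sub_cancel] at h
    have hB' : MeasurableSet ((fun (x : ℝ≥0 → ℝ) s => x s / c) ⁻¹' B) :=
      (measurable_pi_lambda _ fun s => by fun_prop) hB
    have h2 : ∀ᵐ x ∂(P.map fun ω (s : ℝ≥0) => γ (min s u) ω / c⁻¹),
        x ∉ (fun (x : ℝ≥0 → ℝ) s => x s / c) ⁻¹' B := by
      rw [ae_map_iff (hp2 c⁻¹).aemeasurable hB'.compl]
      filter_upwards [hnull] with ω hω
      have he : (fun s => γ (min s u) ω / c⁻¹ / c) = fun s => γ (min s u) ω := by
        ext s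
        field_simp
      rw [Set.mem_preimage, he]
      exact hω
    rw [← h, ae_map_iff hp1.aemeasurable hB'.compl] at h2
    refine (withDensity_absolutelyContinuous' ?_ ?_).ae_le h2
    · have := hm u
      fun_prop
    · exact Eventually.of_forall fun ω => by simp [Real.exp_pos]

/-! ### Densities and bridges of deterministic length -/

/-- The marginal laws of the gamma process at positive times have a density. -/
theorem map_absolutelyContinuous_volume [IsProbabilityMeasure P]
    (hγ : IsStandardGammaProcess γ P) {h : ℝ≥0} (hh : 0 < h) : P.map (γ h) ≪ volume := by
  have hm := hγ.measurable h
  refine Measure.AbsolutelyContinuous.mk fun N hN hN0 => ?_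
  have hp : MeasurableSet {q : ℝ × ℝ | q.1 * q.2 ∉ N} :=
    (by fun_prop : Measurable fun q : ℝ × ℝ => q.1 * q.2) hN.compl
  have h1 : ∀ᵐ r ∂(P.map (γ h)), ∀ᵐ c ∂(volume : Measure ℝ), r * c ∉ N := by
    have h0 : ∀ᵐ r ∂(P.map (γ h)), 0 < r := by
      rw [ae_map_iff hm.aemeasurable measurableSet_Ioi]
      exact hγ.ae_pos hh
    filter_upwards [h0] with r hr
    have := Real.volume_preimage_mul_left hr.ne' N
    rw [hN0, mul_zero] at this
    exact measure_eq_zero_iff_ae_notMem.1 this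
  have : IsProbabilityMeasure (P.map (γ h)) := Measure.isProbabilityMeasure_map hm.aemeasurable
  -- By Fubini some `c > 0` has `c γ_h ∉ N` a.s.; quasi-invariance then removes the factor `c`.
  rw [Measure.ae_ae_comm hp] at h1
  have h2 : ∃ c : ℝ, 0 < c ∧ ∀ᵐ r ∂(P.map (γ h)), r * c ∉ N := by
    by_contra hcon
    push Not at hcon
    have h3 : (volume : Measure ℝ) (Set.Ioi 0) = 0 :=
      measure_mono_null (fun c hc => hcon c hc) h1
    simp at h3
  obtain ⟨c, hc, h2⟩ := h2
  have hNc : MeasurableSet {r : ℝ | r * c ∉ N} := (measurable_mul_const c) hN.compl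
  rw [ae_map_iff hm.aemeasurable hNc] at h2
  have h4 := hγ.ae_scaled_stopped_notMem h hc (B := {x | x h * c ∈ N})
    ((by fun_prop : Measurable fun x : ℝ≥0 → ℝ => x h * c) hN) (by simpa using h2)
  rw [Measure.map_apply hm hN, measure_eq_zero_iff_ae_notMem]
  filter_upwards [h4] with ω hω
  simpa [hc.ne'] using hω

/-- The law of the gamma bridge of deterministic length `T`, restricted to `[0, u]` with `u < T`, is
absolutely continuous with respect to the law of the gamma process on `[0, u]`. -/
theorem ae_bridge_notMem [IsProbabilityMeasure P] (hγ : IsStandardGammaProcess γ P)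
    {u T : ℝ≥0} (hu : u < T) {B : Set (ℝ≥0 → ℝ)} (hB : MeasurableSet B)
    (hnull : ∀ᵐ ω ∂P, (fun s => γ (min s u) ω) ∉ B) :
    ∀ᵐ ω ∂P, (fun s => γ (min s u) ω / γ T ω) ∉ B := by
  have hm := hγ.measurable
  set V : Ω → ℝ≥0 → ℝ := fun ω s => γ (min s u) ω with hV
  set R : Ω → ℝ := fun ω => γ T ω - γ u ω with hR
  have hVm : Measurable V := measurable_pi_lambda _ fun s => hm _
  have hRm : Measurable R := (hm _).sub (hm _)
  have hind : IndepFun V R P := by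
    have hev : Measurable fun x : ℝ≥0 → ℝ => x (T - u) := measurable_pi_apply _
    have h := (indepFun_past_future hm hγ.indep u).comp (φ := id) (ψ := fun x => x (T - u))
      measurable_id hev
    refine h.congr ?_ ?_
    · filter_upwards [hγ.zero] with ω h0
      simp [hV, h0]
    · refine Eventually.of_forall fun ω => ?_
      simp [hR, add_tsub_cancel_of_le hu.le]
  have hRac : P.map R ≪ volume := by
    rw [hR, hγ.map_increment hu.le]
    exact hγ.map_absolutelyContinuous_volume (tsub_pos_of_lt hu)
  have : IsProbabilityMeasure (P.map V) := Measure.isProbabilityMeasure_map hVm.aemeasurable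
  have : IsProbabilityMeasure (P.map R) := Measure.isProbabilityMeasure_map hRm.aemeasurable
  have hS : MeasurableSet {q : (ℝ≥0 → ℝ) × ℝ | 0 < q.2 → (fun s => q.1 s / q.2) ∉ B} := by
    have h1 : MeasurableSet {q : (ℝ≥0 → ℝ) × ℝ | 0 < q.2} :=
      measurableSet_lt measurable_const measurable_snd
    have h2 : MeasurableSet {q : (ℝ≥0 → ℝ) × ℝ | (fun s => q.1 s / q.2) ∉ B} :=
      (measurable_pi_lambda _ fun s => by fun_prop :
        Measurable fun (q : (ℝ≥0 → ℝ) × ℝ) s => q.1 s / q.2) hB.compl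
    exact h1.imp h2
  have h1 : ∀ᵐ c ∂(volume : Measure ℝ), ∀ᵐ v ∂(P.map V), 0 < c → (fun s => v s / c) ∉ B := by
    refine Eventually.of_forall fun c => ?_
    by_cases hc : 0 < c
    · have h2 := hγ.ae_scaled_stopped_notMem u hc hB hnull
      have hSc : MeasurableSet {v : ℝ≥0 → ℝ | 0 < c → (fun s => v s / c) ∉ B} :=
        measurable_prodMk_right (y := c) hS
      rw [ae_map_iff hVm.aemeasurable hSc]
      filter_upwards [h2] with ω hω _ using hω
    · exact Eventually.of_forall fun v h => absurd h hc
  -- With the path `v` fixed, almost every divisor `c` is good. The law of `v u + R` is a translate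
  -- of a law with a density, so it ignores the bad ones.
  rw [← Measure.ae_ae_comm hS] at h1
  have h3 : ∀ᵐ v ∂(P.map V), ∀ᵐ r ∂(P.map R), 0 < v u + r → (fun s => v s / (v u + r)) ∉ B := by
    filter_upwards [h1] with v hv
    exact hRac.ae_le ((measurePreserving_add_left volume (v u)).quasiMeasurePreserving.ae hv)
  have hS' : MeasurableSet {q : (ℝ≥0 → ℝ) × ℝ |
      0 < q.1 u + q.2 → (fun s => q.1 s / (q.1 u + q.2)) ∉ B} :=
    (by fun_prop : Measurable fun q : (ℝ≥0 → ℝ) × ℝ => (q.1, q.1 u + q.2)) hS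
  have h4 := (Measure.ae_prod_iff_ae_ae hS').2 h3
  rw [← hind.map_prod_eq_prod_map_map hVm.aemeasurable hRm.aemeasurable,
    ae_map_iff (hVm.prodMk hRm).aemeasurable hS'] at h4
  filter_upwards [h4, hγ.ae_pos (zero_le.trans_lt hu)] with ω hω hpos
  have : V ω u + R ω = γ T ω := by simp [hV, hR]
  rw [this] at hω
  exact hω hpos

end IsStandardGammaProcess

/-! ### Evaluation at a random time and bridges of random length -/

/-- A sequence of discrete times decreasing to `T`, strictly larger than `T`. -/
noncomputable def rightApprox (n : ℕ) (T : ℝ≥0) : ℝ≥0 :=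
  ((⌊T * (n + 1)⌋₊ : ℝ≥0) + 1) / (n + 1)

theorem lt_rightApprox (n : ℕ) (T : ℝ≥0) : T < rightApprox n T := by
  unfold rightApprox
  rw [lt_div_iff₀ (by positivity)]
  exact Nat.lt_floor_add_one _

theorem rightApprox_le (n : ℕ) (T : ℝ≥0) : rightApprox n T ≤ T + 1 / (n + 1) := by
  unfold rightApprox
  rw [div_le_iff₀ (by positivity), add_mul, one_div, inv_mul_cancel₀ (by positivity)]
  gcongr
  exact Nat.floor_le zero_le

theorem tendsto_rightApprox (T : ℝ≥0) :
    Tendsto (fun n => rightApprox n T) atTop (𝓝[>] T) := by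
  refine tendsto_nhdsWithin_iff.2 ⟨?_, Eventually.of_forall fun n => lt_rightApprox n T⟩
  refine tendsto_of_tendsto_of_tendsto_of_le_of_le tendsto_const_nhds ?_
    (fun n => (lt_rightApprox n T).le) (fun n => rightApprox_le n T)
  have h : Tendsto (fun n : ℕ => T + 1 / ((n : ℝ≥0) + 1)) atTop (𝓝 (T + 0)) :=
    tendsto_const_nhds.add tendsto_one_div_add_atTop_nhds_zero_nat
  simpa using h

/-- The value at time `T` of a right-continuous path, as a jointly measurable function. -/
noncomputable def evalRight (q : ℝ≥0 × (ℝ≥0 → ℝ)) : ℝ :=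
  limsup (fun n => q.2 (rightApprox n q.1)) atTop

/-- Evaluation `(T, x) ↦ x T` is not measurable for the product σ-algebra, but `rightApprox n` takes
countably many values, indexed by a floor. -/
theorem measurable_evalRight : Measurable evalRight := by
  refine Measurable.limsup fun n => ?_
  have h1 : Measurable fun q : ℕ × (ℝ≥0 → ℝ) => q.2 (((q.1 : ℝ≥0) + 1) / (n + 1)) :=
    measurable_from_prod_countable_right fun k => measurable_pi_apply (((k : ℝ≥0) + 1) / (n + 1))
  have h2 : Measurable fun q : ℝ≥0 × (ℝ≥0 → ℝ) => ⌊q.1 * (n + 1)⌋₊ :=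
    Nat.measurable_floor.comp (by fun_prop)
  exact h1.comp (h2.prodMk measurable_snd)

theorem evalRight_eq {T : ℝ≥0} {x : ℝ≥0 → ℝ} (hx : ContinuousWithinAt x (Set.Ioi T) T) :
    evalRight (T, x) = x T :=
  (hx.tendsto.comp (tendsto_rightApprox T)).limsup_eq

variable {τ : Ω → ℝ≥0}

/-- Right-continuity holds only almost surely, so `evalRight` yields a.e. measurability;
completeness of `P` upgrades it. -/
theorem measurable_randomBridge [P.IsComplete] (hm : ∀ t, Measurable (γ t))
    (hrc : ∀ᵐ ω ∂P, ∀ t : ℝ≥0, ContinuousWithinAt (fun s => γ s ω) (Set.Ioi t) t)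
    (hτ : Measurable τ) (t : ℝ≥0) : Measurable (randomBridge γ τ t) := by
  rw [← aemeasurable_iff_measurable (μ := P)]
  have hp : Measurable fun ω s => γ s ω := measurable_pi_lambda _ hm
  refine ⟨fun ω => evalRight (min t (τ ω), fun s => γ s ω) / evalRight (τ ω, fun s => γ s ω),
    (measurable_evalRight.comp ((measurable_const.min hτ).prodMk hp)).div
      (measurable_evalRight.comp (hτ.prodMk hp)), ?_⟩
  filter_upwards [hrc] with ω hω
  rw [evalRight_eq (hω _), evalRight_eq (hω _)]
  rfl

/-- On `{u < τ}`, the law of the gamma bridge of random length `τ` up to time `u` is absolutely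
continuous with respect to the law of the gamma process. -/
theorem IsStandardGammaProcess.ae_randomBridge_notMem [IsProbabilityMeasure P]
    (hγ : IsStandardGammaProcess γ P) (hτ : Measurable τ)
    (hindep : IndepFun τ (fun ω t => γ t ω) P) {u : ℝ≥0} {B : Set (ℝ≥0 → ℝ)}
    (hB : MeasurableSet[naturalSigma (fun s (x : ℝ≥0 → ℝ) => x s) u] B)
    (hnull : ∀ᵐ ω ∂P, (fun s => γ s ω) ∉ B) :
    ∀ᵐ ω ∂P, u < τ ω → (fun s => randomBridge γ τ s ω) ∉ B := by
  have hBm : MeasurableSet B := pathSigma_le u B hB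
  have hp : Measurable fun ω s => γ s ω := measurable_pi_lambda _ hγ.measurable
  have hnull' : ∀ᵐ ω ∂P, (fun s => γ (min s u) ω) ∉ B := by
    filter_upwards [hnull] with ω hω
    rwa [mem_iff_stopped_mem hB] at hω
  have hS : MeasurableSet {q : ℝ≥0 × (ℝ≥0 → ℝ) |
      u < q.1 → (fun s => q.2 (min s u) / evalRight q) ∉ B} := by
    have h1 : MeasurableSet {q : ℝ≥0 × (ℝ≥0 → ℝ) | u < q.1} :=
      measurableSet_lt measurable_const measurable_fst
    have h2 : Measurable fun (q : ℝ≥0 × (ℝ≥0 → ℝ)) s => q.2 (min s u) / evalRight q :=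
      measurable_pi_lambda _ fun s =>
        ((measurable_pi_apply (min s u)).comp measurable_snd).div measurable_evalRight
    exact h1.imp (h2 hBm.compl)
  have h1 : ∀ᵐ T ∂(P.map τ), ∀ᵐ x ∂(P.map fun ω s => γ s ω),
      u < T → (fun s => x (min s u) / evalRight (T, x)) ∉ B := by
    refine Eventually.of_forall fun T => ?_
    have hST : MeasurableSet {x : ℝ≥0 → ℝ |
        u < T → (fun s => x (min s u) / evalRight (T, x)) ∉ B} := measurable_prodMk_left hS
    rw [ae_map_iff hp.aemeasurable hST]
    by_cases hT : u < T
    · filter_upwards [hγ.ae_bridge_notMem hT hBm hnull', hγ.rightCont] with ω hω hrc _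
      rwa [evalRight_eq (hrc T)]
    · exact Eventually.of_forall fun ω h => absurd h hT
  have : IsProbabilityMeasure (P.map τ) := Measure.isProbabilityMeasure_map hτ.aemeasurable
  have : IsProbabilityMeasure (P.map fun ω s => γ s ω) :=
    Measure.isProbabilityMeasure_map hp.aemeasurable
  have h2 := (Measure.ae_prod_iff_ae_ae hS).2 h1
  rw [← hindep.map_prod_eq_prod_map_map hτ.aemeasurable hp.aemeasurable,
    ae_map_iff (hτ.prodMk hp).aemeasurable hS] at h2
  filter_upwards [h2, hγ.rightCont] with ω hω hrc hu
  rw [mem_iff_stopped_mem hB]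
  have h3 := hω hu
  rw [evalRight_eq (hrc (τ ω))] at h3
  simpa [randomBridge, min_eq_left ((min_le_right _ u).trans hu.le)] using h3

/-! ### Completed σ-algebras -/

theorem measurableSet_completedNaturalSigma_of_null (Y : ℝ≥0 → Ω → ℝ) (t : ℝ≥0) {N : Set Ω}
    (hN : P N = 0) : MeasurableSet[completedNaturalSigma Y P t] N :=
  (le_sup_right : _ ≤ completedNaturalSigma Y P t) _ (MeasurableSpace.measurableSet_generateFrom hN)

/-- The events of the completed σ-algebra are those that agree with an event of the original one
up to a null set. -/
theorem measurableSet_completedNaturalSigma_iff {Y : ℝ≥0 → Ω → ℝ} {t : ℝ≥0} {A : Set Ω} :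
    MeasurableSet[completedNaturalSigma Y P t] A ↔
      ∃ C, MeasurableSet[naturalSigma Y t] C ∧ A =ᵐ[P] C := by
  constructor
  · intro hA
    have hle : completedNaturalSigma Y P t ≤
        eventuallyMeasurableSpace (naturalSigma Y t) (ae P) := by
      refine sup_le (fun C hC => ⟨C, hC, .rfl⟩)
        (MeasurableSpace.generateFrom_le fun N hN => ?_)
      exact ⟨∅, @MeasurableSet.empty _ (naturalSigma Y t), ae_eq_empty.2 hN⟩
    exact hle A hA
  · rintro ⟨C, hC, hAC⟩
    have hC' : MeasurableSet[completedNaturalSigma Y P t] C :=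
      (le_sup_left : naturalSigma Y t ≤ completedNaturalSigma Y P t) C hC
    have h := ae_eq_set.1 hAC
    have e : A = (C \ (C \ A)) ∪ (A \ C) := by
      ext ω
      simp only [Set.mem_union, Set.mem_sdiff]
      tauto
    rw [e]
    exact @MeasurableSet.union _ (completedNaturalSigma Y P t) _ _
      (@MeasurableSet.diff _ (completedNaturalSigma Y P t) _ _ hC'
        (measurableSet_completedNaturalSigma_of_null Y t h.2))
      (measurableSet_completedNaturalSigma_of_null Y t h.1)

/-- An event of all completed σ-algebras after `t` is, up to a null set, an event of the germ
σ-algebra of the path space at `t`. -/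
theorem exists_germ_path_event {Y : ℝ≥0 → Ω → ℝ} {t : ℝ≥0} {A : Set Ω}
    (hA : ∀ u > t, MeasurableSet[completedNaturalSigma Y P u] A) :
    ∃ B : Set (ℝ≥0 → ℝ),
      (∀ u > t, MeasurableSet[naturalSigma (fun s (x : ℝ≥0 → ℝ) => x s) u] B) ∧
      ∀ᵐ ω ∂P, ω ∈ A ↔ (fun s => Y s ω) ∈ B := by
  obtain ⟨v, hvanti, hvt, hv⟩ := exists_seq_strictAnti_tendsto t
  have h1 : ∀ n, ∃ B : Set (ℝ≥0 → ℝ),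
      MeasurableSet[naturalSigma (fun s (x : ℝ≥0 → ℝ) => x s) (v n)] B ∧
      ∀ᵐ ω ∂P, ω ∈ A ↔ (fun s => Y s ω) ∈ B := by
    intro n
    obtain ⟨C, hC, hAC⟩ := measurableSet_completedNaturalSigma_iff.1 (hA (v n) (hvt n))
    rw [naturalSigma_eq_comap_path] at hC
    obtain ⟨B, hB, rfl⟩ := hC
    exact ⟨B, hB, eventuallyEq_set.1 hAC⟩
  choose B hB hAB using h1
  -- The limsup ignores any finite number of the `B n`, hence depends only on the path up to `u` for
  -- every `u > t`.
  refine ⟨{x | ∃ᶠ n in atTop, x ∈ B n}, fun u hu => ?_, ?_⟩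
  · obtain ⟨N, hN⟩ := eventually_atTop.1 (hv.eventually (gt_mem_nhds hu))
    have e : {x | ∃ᶠ n in atTop, x ∈ B n} = ⋂ m : ℕ, ⋃ n : ℕ, B (N + m + n) := by
      ext x
      simp only [Set.mem_iInter, Set.mem_iUnion]
      constructor
      · intro (hx : ∃ᶠ n in atTop, x ∈ B n) m
        obtain ⟨n, hn, hxn⟩ := frequently_atTop.1 hx (N + m)
        exact ⟨n - (N + m), by rwa [Nat.add_sub_cancel' hn]⟩
      · intro hx
        refine frequently_atTop.2 fun m => ?_
        obtain ⟨n, hn⟩ := hx m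
        exact ⟨N + m + n, by omega, hn⟩
    rw [e]
    refine MeasurableSet.iInter fun m => MeasurableSet.iUnion fun n => ?_
    exact naturalSigma_mono _ (hN (N + m + n) (by omega)).le _ (hB _)
  · filter_upwards [ae_all_iff.2 hAB] with ω hω
    have : ∀ n, (fun s => Y s ω) ∈ B n ↔ ω ∈ A := fun n => (hω n).symm
    simp [this]

/-! ### Right-continuity of the bridge filtration -/

/-- Strict monotonicity makes `γ_{t ∧ τ} = γ_τ` equivalent to `τ ≤ t`, and `τ > 0` keeps the
denominator positive. -/
theorem IsStandardGammaProcess.ae_le_iff_randomBridge_eq_one [IsProbabilityMeasure P]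
    (hγ : IsStandardGammaProcess γ P) (hτ_pos : ∀ ω, 0 < τ ω) (t : ℝ≥0) :
    ∀ᵐ ω ∂P, τ ω ≤ t ↔ randomBridge γ τ t ω = 1 := by
  filter_upwards [hγ.ae_strictMono, hγ.zero] with ω hmono h0
  have hpos : 0 < γ (τ ω) ω := by
    rw [← h0]
    exact hmono (hτ_pos ω)
  unfold randomBridge
  rw [div_eq_one_iff_eq hpos.ne', hmono.injective.eq_iff, min_eq_right_iff]

/-- The completed natural filtration of the gamma bridge of random length is right-continuous. -/
theorem IsStandardGammaProcess.measurableSet_of_forall_gt [IsProbabilityMeasure P]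
    (hγ : IsStandardGammaProcess γ P) (hτ : Measurable τ) (hτ_pos : ∀ ω, 0 < τ ω)
    (hindep : IndepFun τ (fun ω t => γ t ω) P) {t : ℝ≥0} {A : Set Ω}
    (hA : ∀ u > t, MeasurableSet[completedNaturalSigma (randomBridge γ τ) P u] A) :
    MeasurableSet[completedNaturalSigma (randomBridge γ τ) P t] A := by
  obtain ⟨B, hB, hAB⟩ := exists_germ_path_event hA
  have hBγ : ∀ u > t, MeasurableSet[naturalSigma γ u] ((fun ω s => γ s ω) ⁻¹' B) := by
    intro u hu
    rw [naturalSigma_eq_comap_path]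
    exact ⟨B, hB u hu, rfl⟩
  obtain ⟨C, hC, hBC⟩ := exists_measurableSet_naturalSigma_ae_eq hγ.measurable hγ.zero hγ.indep
    hγ.rightCont t hBγ
  rw [naturalSigma_eq_comap_path] at hC
  obtain ⟨C, hC, rfl⟩ := hC
  have hbefore : ∀ᵐ ω ∂P, t < τ ω → ((fun s => randomBridge γ τ s ω) ∈ B ↔
      (fun s => randomBridge γ τ s ω) ∈ C) := by
    obtain ⟨v, -, hvt, hv⟩ := exists_seq_strictAnti_tendsto t
    have h1 : ∀ n, ∀ᵐ ω ∂P, v n < τ ω →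
        (fun s => randomBridge γ τ s ω) ∉ symmDiff B C := by
      intro n
      refine hγ.ae_randomBridge_notMem hτ hindep ?_ ?_
      · have hC' := naturalSigma_mono _ (hvt n).le _ hC
        exact ((hB _ (hvt n)).diff hC').union (hC'.diff (hB _ (hvt n)))
      · filter_upwards [eventuallyEq_set.1 hBC] with ω hω
        simp only [Set.mem_preimage] at hω
        simp [Set.mem_symmDiff, hω]
    filter_upwards [ae_all_iff.2 h1] with ω hω ht
    obtain ⟨n, hn⟩ := (hv.eventually (gt_mem_nhds ht)).exists
    have := hω n hn
    rw [Set.mem_symmDiff] at this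
    tauto
  -- `C` serves while `ζ_t ≠ 1`. Once `ζ_t = 1` the path equals its stopped version a.s., so testing
  -- the stopped path against `B` needs no information after `t`.
  refine measurableSet_completedNaturalSigma_iff.2
    ⟨((randomBridge γ τ t ⁻¹' {1})ᶜ ∩ (fun ω s => randomBridge γ τ s ω) ⁻¹' C) ∪
      (randomBridge γ τ t ⁻¹' {1} ∩ (fun ω s => randomBridge γ τ (min s t) ω) ⁻¹' B), ?_, ?_⟩
  · have hone : MeasurableSet[naturalSigma (randomBridge γ τ) t]
        (randomBridge γ τ t ⁻¹' {1}) :=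
      (le_iSup₂_of_le t le_rfl le_rfl :
        MeasurableSpace.comap (randomBridge γ τ t) inferInstance ≤ naturalSigma _ t) _
        ⟨{1}, measurableSet_singleton 1, rfl⟩
    have hCt : MeasurableSet[naturalSigma (randomBridge γ τ) t]
        ((fun ω s => randomBridge γ τ s ω) ⁻¹' C) := by
      rw [naturalSigma_eq_comap_path]
      exact ⟨C, hC, rfl⟩
    have hBt : MeasurableSet[naturalSigma (randomBridge γ τ) t]
        ((fun ω s => randomBridge γ τ (min s t) ω) ⁻¹' B) := by
      rw [naturalSigma_eq_comap_stopped]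
      exact ⟨B, pathSigma_le _ B (hB (t + 1) (by simp)), rfl⟩
    exact (hone.compl.inter hCt).union (hone.inter hBt)
  · rw [eventuallyEq_set]
    filter_upwards [hAB, hbefore, hγ.ae_le_iff_randomBridge_eq_one hτ_pos t] with ω h1 h2 h3
    rw [h1]
    simp only [Set.mem_union, Set.mem_inter_iff, Set.mem_compl_iff, Set.mem_preimage,
      Set.mem_singleton_iff, ← h3]
    by_cases h : τ ω ≤ t
    · have e : (fun s => randomBridge γ τ (min s t) ω) = fun s => randomBridge γ τ s ω := by
        ext s
        simp [randomBridge, min_assoc, min_eq_right h]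
      simp [h, e]
    · simp [h, h2 (not_le.1 h)]

end GammaBridge

theorem mainTheorem4 {Ω : Type*} [mΩ : MeasurableSpace Ω] (P : Measure Ω)
    [IsProbabilityMeasure P] [P.IsComplete]
    (γ : ℝ≥0 → Ω → ℝ) (hγ : GammaBridge.IsStandardGammaProcess γ P)
    (τ : Ω → ℝ≥0) (hτ : Measurable τ) (hτ_pos : ∀ ω, 0 < τ ω)
    (hindep : IndepFun τ (fun ω t => γ t ω) P)
    (hmoment : ∃ α : ℝ, 0 < α ∧ Integrable (fun ω => (τ ω : ℝ) ^ α) P) :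
    ∃ 𝓕 : Filtration ℝ≥0 mΩ,
      (∀ t, 𝓕 t =
        GammaBridge.completedNaturalSigma (GammaBridge.randomBridge γ τ) P t) ∧
      GammaBridge.UsualConditions 𝓕 P := by
  refine ⟨⟨fun t => GammaBridge.completedNaturalSigma (GammaBridge.randomBridge γ τ) P t,
    fun s t hst => sup_le_sup_right (GammaBridge.naturalSigma_mono _ hst) _, fun t => ?_⟩,
    fun t => rfl, ⟨⟨fun t => ?_⟩, fun N hN => ?_⟩⟩
  · refine sup_le (GammaBridge.naturalSigma_le
      (GammaBridge.measurable_randomBridge (P := P) hγ.measurable hγ.rightCont hτ) t)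
      (MeasurableSpace.generateFrom_le fun N hN => ?_)
    exact Measure.IsComplete.out' N hN
  · rw [Filtration.rightCont_eq]
    intro A hA
    refine hγ.measurableSet_of_forall_gt hτ hτ_pos hindep fun u hu => ?_
    simp only [MeasurableSpace.measurableSet_iInf] at hA
    exact hA u hu
  · exact GammaBridge.measurableSet_completedNaturalSigma_of_null _ 0 hN
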